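/- All spaces are regular $T_1$ topological spaces, and all maps are continuous and closed. For disjoint sets $A,B\subset X$, a closed set $L\subset X$ is a partition in $X$ between $A$ and $B$ if $X\setminus L=U\cup V$ for some disjoint open sets $U\supset A$ and $V\supset B$. For normal spaces $X$, the dimension $\operatorname{Ind}_0X\in\{-1,0,1,2,\dots,\infty\}$ is defined inductively: $\operatorname{Ind}_0X=-1$ iff $X=\emptyset$; for $n\ge 0$, $\operatorname{Ind}_0X\le n$ iff for every pair of disjoint closed sets $A,B\subset X$ there is a $G_\delta$ partition $L$ in $X$ between $A$ and $B$ with $\operatorname{Ind}_0L\le n-1$; $\operatorname{Ind}_0 X=n$ iff $\operatorname{Ind}_0 X\le n$ but not $\operatorname{Ind}_0 X\le n-1$; and $\operatorname{Ind}_0X=\infty$ if $\operatorname{Ind}_0X\le n$ holds for no $n$. For a map $f\colon X\to Y$ put $\operatorname{Ind}_0f=\sup\{\operatorname{Ind}_0f^{-1}(y):y\in Y\}$. The map $f$ is ring-like if for every $x\in X$ and all open sets $U\ni x$ and $V\ni f(x)$ there is an open set $V'\ni f(x)$ with $V'\subset V$ and $f^{-1}(\operatorname{Fr}V')\subset U$,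 where $\operatorname{Fr}$ denotes the boundary; $f$ is fully closed if for every pair of disjoint closed sets $F,G\subset X$ the set $f(F)\cap f(G)$ is a discrete subspace of $Y$. **Theorem.** Let $f$ be a ring-like fully closed map from a non-empty compact space $X$ onto a first countable space $Y$. If $\operatorname{Ind}_0f^{-1}(y)=\operatorname{Ind}_0f$ for every $y\in Y$, then $$\operatorname{Ind}_0X=\operatorname{Ind}_0Y+\operatorname{Ind}_0f$$ (where a sum with an infinite summand is $\infty$). -/

import Mathlib

open Set Topology

/-- `L` is a partition in `X` between `A` and `B`: a closed set whose complement is the union of two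
disjoint open sets, one containing `A` and the other containing `B`. -/
def IsPartitionBetween {X : Type*} [TopologicalSpace X] (L A B : Set X) : Prop :=
  IsClosed L ∧ ∃ U V : Set X, IsOpen U ∧ IsOpen V ∧ Disjoint U V ∧ Lᶜ = U ∪ V ∧ A ⊆ U ∧ B ⊆ V

/-- `IndZeroLT n X` says that `Ind₀ X ≤ n - 1`: the space `X` is empty if `n = 0`, and for `n + 1`
any two disjoint closed sets can be separated by a `Gδ` partition `L` with `Ind₀ L ≤ n - 1`. -/
def IndZeroLT.{u} : ℕ → (X : Type u) → [TopologicalSpace X] → Prop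
  | 0, X, _ => IsEmpty X
  | n + 1, X, _ => ∀ A B : Set X, IsClosed A → IsClosed B → Disjoint A B →
      ∃ L : Set X, IsGδ L ∧ IsPartitionBetween L A B ∧ IndZeroLT n L

/-- The Charalambous-Filippov-Ivanov inductive dimension `Ind₀ X`. Here `⊥` stands for the
value `-1` (taken exactly at the empty space) and `⊤` for the value `∞`. -/
noncomputable def indZero (X : Type*) [TopologicalSpace X] : WithBot ℕ∞ :=
  sInf {d | ∀ i : ℕ, d < i → IndZeroLT i X}

/-- The fiberwise dimension `Ind₀ f`, the supremum of `Ind₀` over the point-inverses of `f`. -/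
noncomputable def indZeroMap {X Y : Type*} [TopologicalSpace X] (f : X → Y) : WithBot ℕ∞ :=
  ⨆ y : Y, indZero (f ⁻¹' {y})

/-- Ring-like (closed continuous) maps. -/
structure IsRingLike {X Y : Type*} [TopologicalSpace X] [TopologicalSpace Y] (f : X → Y) :
    Prop where
  continuous : Continuous f
  isClosedMap : IsClosedMap f
  exists_frontier : ∀ (x : X) (U : Set X) (V : Set Y), IsOpen U → x ∈ U → IsOpen V → f x ∈ V →
    ∃ V' : Set Y, IsOpen V' ∧ f x ∈ V' ∧ V' ⊆ V ∧ f ⁻¹' (frontier V') ⊆ U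

/-- Fully closed (continuous) maps. -/
structure IsFullyClosed {X Y : Type*} [TopologicalSpace X] [TopologicalSpace Y] (f : X → Y) :
    Prop where
  continuous : Continuous f
  isClosedMap : IsClosedMap f
  isDiscrete_inter : ∀ F G : Set X, IsClosed F → IsClosed G → Disjoint F G →
    IsDiscrete (f '' F ∩ f '' G)

/-!
The equality is proved as two inequalities, in terms of closed sets `Z` inside a fixed compact space
`X` and continuous functions on `X`. Since closed `Gδ` sets in compact spaces are zero sets,
`Ind₀ Z ≤ n` means that any two disjoint closed sets are separated in `Z` by a function whose zero
set in `Z` has `Ind₀ ≤ n - 1` (`IndLT`, `indZeroLT_iff_indLT_range`). In this language, separating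
functions may be taken as small perturbations of given ones (`IndLT.exists_perturb`), which gives
the countable sum theorem for zero sets (`IndLT.of_iUnion`).

*Upper bound* (`IsFullyClosed.indLT_add`). A function `u` separating `A` and `B` in `X` has large
oscillation on finitely many fibers only, since `f` is fully closed. Let `S ⊆ Y` be the set of their
images. On the fibers over `S`, perturb `u` so that its zero set there has dimension at most
`Ind₀ f - 1`. As `S` is a `Gδ` set, by first countability, there is a function `τ` on `Y` vanishing
exactly on `S`; it can be chosen so as to dominate the oscillation of `u` on the other fibers. Off
the fibers over `S`, replace `u` by a `τ`-close function that is constant on fibers, and perturb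
this function on `Y` to make its zero set off `S` a countable union of sets of dimension at most
`Ind₀ Y - 1`. The zero set of the resulting function on `X` is covered by countably many zero sets
whose dimension is bounded by induction.

*Lower bound* (`IsRingLike.indLT_of_indLT_preimage`). Let `h` separate the preimages of two closed
sets `A` and `B` of `Y`. A ring-like fully closed map admits a `Gδ` partition `L` between `A` and `B`
whose full preimage lies in `{h = 0}` (`IsRingLike.exists_partition`). By induction, this gives
`Ind₀ Y + k ≤ Ind₀ X` whenever all fibers have dimension at least `k`.
-/

/-! ### Suprema and limits of sequences of continuous functions -/

/-- If nonnegative continuous functions `r j` are bounded by constants tending to zero, then their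
supremum is continuous, and it is attained wherever it is nonzero. -/
lemma exists_continuous_sup {X : Type*} [TopologicalSpace X] (r : ℕ → C(X, ℝ)) (ε : ℕ → ℝ)
    (hε : Filter.Tendsto ε Filter.atTop (𝓝 0)) (h0 : ∀ j x, 0 ≤ r j x)
    (hr : ∀ j x, r j x ≤ ε j) :
    ∃ R : C(X, ℝ), ∀ x, (∀ j, r j x ≤ R x) ∧ (R x = 0 ∨ ∃ j, R x = r j x) := by
  obtain ⟨C, hC⟩ := hε.bddAbove_range
  have bdd : ∀ x, BddAbove (range fun j => r j x) := fun x =>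
    ⟨C, by rintro _ ⟨j, rfl⟩; exact (hr j x).trans (hC ⟨j, rfl⟩)⟩
  let P : ℕ → X → ℝ := fun N => Nat.rec (fun _ => 0) (fun n p x => max (p x) (r n x)) N
  have P0 : ∀ x, P 0 x = 0 := fun x => rfl
  have PS : ∀ N x, P (N + 1) x = max (P N x) (r N x) := fun N x => rfl
  have Pc : ∀ N, Continuous (P N) := by
    intro N
    induction N with
    | zero => exact continuous_const
    | succ N ih => exact ih.max (r N).continuous
  have Pr : ∀ N x, ∀ j < N, r j x ≤ P N x := by
    intro N x
    induction N with
    | zero => intro j hj; omega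
    | succ N ih =>
      intro j hj
      rw [PS]
      rcases Nat.lt_succ_iff_lt_or_eq.1 hj with h | rfl
      · exact (ih j h).trans (le_max_left _ _)
      · exact le_max_right _ _
  have Pa : ∀ N x, P N x = 0 ∨ ∃ j, P N x = r j x := by
    intro N x
    induction N with
    | zero => exact Or.inl rfl
    | succ N ih =>
      rw [PS]
      rcases max_choice (P N x) (r N x) with h | h <;> rw [h]
      · exact ih
      · exact Or.inr ⟨N, rfl⟩
  have PR : ∀ N x, P N x ≤ ⨆ j, r j x := by
    intro N x
    rcases Pa N x with h | ⟨j, h⟩ <;> rw [h]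
    · exact (h0 0 x).trans (le_ciSup (bdd x) 0)
    · exact le_ciSup (bdd x) j
  have RP : ∀ η > 0, ∃ N, ∀ x, ⨆ j, r j x ≤ max (P N x) η := by
    intro η hη
    obtain ⟨N, hN⟩ := Filter.eventually_atTop.1 (hε.eventually (gt_mem_nhds hη))
    refine ⟨N, fun x => ciSup_le fun j => ?_⟩
    rcases lt_or_ge j N with h | h
    · exact (Pr N x j h).trans (le_max_left _ _)
    · exact ((hr j x).trans (hN j h).le).trans (le_max_right _ _)
  have P0' : ∀ N x, 0 ≤ P N x := by
    intro N x
    rcases Pa N x with h | ⟨j, h⟩ <;> rw [h]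
    exact h0 j x
  refine ⟨⟨fun x => ⨆ j, r j x, ?_⟩, fun x => ⟨fun j => le_ciSup (bdd x) j, ?_⟩⟩
  · refine continuous_of_uniform_approx_of_continuous fun u hu => ?_
    obtain ⟨η, hη, hu⟩ := Metric.mem_uniformity_dist.1 hu
    obtain ⟨N, hN⟩ := RP (η / 2) (by positivity)
    refine ⟨P N, Pc N, fun y => hu ?_⟩
    have h1 := PR N y
    have h2 := hN y
    have h3 := P0' N y
    rw [Real.dist_eq, abs_of_nonneg (by linarith)]
    rcases max_cases (P N y) (η / 2) with h | h <;> linarith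
  · show (⨆ j, r j x) = 0 ∨ ∃ j, (⨆ j, r j x) = r j x
    by_cases hR : (⨆ j, r j x) = 0
    · exact Or.inl hR
    have hpos : 0 < ⨆ j, r j x :=
      lt_of_le_of_ne ((h0 0 x).trans (le_ciSup (bdd x) 0)) (Ne.symm hR)
    obtain ⟨N, hN⟩ := RP ((⨆ j, r j x) / 2) (by positivity)
    have h2 := hN x
    have h4 : (⨆ j, r j x) = P N x := by
      refine le_antisymm ?_ (PR N x)
      rcases le_max_iff.1 h2 with h | h <;> linarith
    rw [h4] at hR ⊢
    exact Pa N x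

/-- A sequence of functions whose successive distances decay geometrically has a continuous limit,
which agrees with the sequence wherever the latter is eventually constant. -/
lemma exists_continuous_lim {X : Type*} [TopologicalSpace X] [CompactSpace X] (v : ℕ → C(X, ℝ))
    (hv : ∀ i x, |v (i + 1) x - v i x| ≤ (1 / 2) ^ i) :
    ∃ w : C(X, ℝ), (∀ x, |w x - v 0 x| ≤ 2) ∧
      ∀ x N, (∀ i ≥ N, v (i + 1) x = v i x) → w x = v N x := by
  have hdist : ∀ i, dist (v i) (v (i + 1)) ≤ 2 / 2 / 2 ^ i := fun i => by
    rw [ContinuousMap.dist_le (by positivity)]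
    intro x
    rw [dist_comm, Real.dist_eq]
    refine (hv i x).trans (le_of_eq ?_)
    simp
  obtain ⟨w, hw⟩ := cauchySeq_tendsto_of_complete (cauchySeq_of_le_geometric_two hdist)
  refine ⟨w, fun x => ?_, fun x N hN => ?_⟩
  · have h1 := dist_le_of_le_geometric_two_of_tendsto₀ hdist hw
    rw [abs_sub_comm, ← Real.dist_eq]
    exact (ContinuousMap.dist_apply_le_dist x).trans h1
  · have h1 : Filter.Tendsto (fun i => v i x) Filter.atTop (𝓝 (w x)) :=
      ((continuous_eval_const (F := C(X, ℝ)) x).tendsto w).comp hw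
    refine tendsto_nhds_unique h1 (tendsto_const_nhds.congr' ?_)
    filter_upwards [Filter.eventually_ge_atTop N] with i hi
    induction i, hi using Nat.le_induction with
    | base => rfl
    | succ i hi ih => rw [ih, hN i hi]

/-! ### The dimension of subsets in terms of continuous functions -/

/-- `IndLT n Z` expresses `Ind₀ Z ≤ n - 1` for a subset `Z` of an ambient space by means of
continuous functions on the ambient space: partitions are the zero sets of functions that are
negative on one of the given closed sets and positive on the other. -/
def IndLT {X : Type*} [TopologicalSpace X] : ℕ → Set X → Prop
  | 0, Z => Z = ∅
  | n + 1, Z => ∀ A B : Set X, IsClosed A → IsClosed B → Disjoint A B →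
      ∃ h : C(X, ℝ), (∀ x ∈ A ∩ Z, h x < 0) ∧ (∀ x ∈ B ∩ Z, 0 < h x) ∧ IndLT n (Z ∩ {x | h x = 0})

section IndLT

variable {X : Type*} [TopologicalSpace X]

lemma IndLT.subset {n : ℕ} {Z W : Set X} (hZ : IndLT n Z) (hW : W ⊆ Z) : IndLT n W := by
  induction n generalizing Z W with
  | zero => exact subset_eq_empty hW hZ
  | succ n ih =>
    intro A B hA hB hAB
    obtain ⟨h, h1, h2, h3⟩ := hZ A B hA hB hAB
    exact ⟨h, fun x hx => h1 x ⟨hx.1, hW hx.2⟩, fun x hx => h2 x ⟨hx.1, hW hx.2⟩,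
      ih h3 (inter_subset_inter_left _ hW)⟩

lemma IndLT.empty (n : ℕ) : IndLT n (∅ : Set X) := by
  induction n with
  | zero => rfl
  | succ n ih =>
    intro A B _ _ _
    exact ⟨0, by simp, by simp, by simpa using ih⟩

lemma IndLT.succ {n : ℕ} {Z : Set X} (hZ : IndLT n Z) : IndLT (n + 1) Z := by
  induction n generalizing Z with
  | zero => rw [show Z = ∅ from hZ]; exact IndLT.empty _
  | succ n ih =>
    intro A B hA hB hAB
    obtain ⟨h, h1, h2, h3⟩ := hZ A B hA hB hAB
    exact ⟨h, h1, h2, ih h3⟩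

lemma IndLT.mono {n m : ℕ} (hnm : n ≤ m) {Z : Set X} (hZ : IndLT n Z) : IndLT m Z := by
  induction m, hnm using Nat.le_induction with
  | base => exact hZ
  | succ m _ ih => exact ih.succ

/-- Every continuous function can be perturbed by at most a prescribed constant so that its zero
set in `Z` has smaller dimension. -/
lemma IndLT.exists_perturb_const {n : ℕ} {Z : Set X} (hZ : IndLT (n + 1) Z) (u : C(X, ℝ))
    {ε : ℝ} (hε : 0 < ε) :
    ∃ v : C(X, ℝ), (∀ x, |v x - u x| ≤ ε) ∧ IndLT n (Z ∩ {x | v x = 0}) := by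
  obtain ⟨h, h1, h2, h3⟩ := hZ {x | u x ≤ -ε} {x | ε ≤ u x}
    (isClosed_le u.continuous continuous_const) (isClosed_le continuous_const u.continuous)
    (disjoint_left.2 fun x (hx : u x ≤ -ε) (hx' : ε ≤ u x) => by linarith)
  -- Truncating `h` to the interval `[u - ε, u + ε]` does not change its zeros in `Z`.
  refine ⟨⟨fun x => max (u x - ε) (min (u x + ε) (h x)), by fun_prop⟩, fun x => ?_,
    h3.subset fun x ⟨hx, hx0⟩ => ⟨hx, ?_⟩⟩
  · simp only [ContinuousMap.coe_mk, abs_le]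
    constructor
    · linarith [le_max_left (u x - ε) (min (u x + ε) (h x))]
    · linarith [max_le (show u x - ε ≤ u x + ε by linarith) (min_le_left (u x + ε) (h x))]
  · have hx0' : max (u x - ε) (min (u x + ε) (h x)) = 0 := hx0
    show h x = 0
    by_cases ha : u x ≤ -ε
    · have := h1 x ⟨ha, hx⟩
      rcases max_cases (u x - ε) (min (u x + ε) (h x)) with h' | h' <;>
      rcases min_cases (u x + ε) (h x) with h'' | h'' <;> linarith
    by_cases hb : ε ≤ u x
    · have := h2 x ⟨hb, hx⟩
      rcases max_cases (u x - ε) (min (u x + ε) (h x)) with h' | h' <;>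
      rcases min_cases (u x + ε) (h x) with h'' | h'' <;> linarith
    · rcases max_cases (u x - ε) (min (u x + ε) (h x)) with h' | h' <;>
      rcases min_cases (u x + ε) (h x) with h'' | h'' <;> linarith

/-- Every continuous function `u` can be perturbed by at most a prescribed continuous function
`s ≥ 0` so that its zero set in `Z ∩ {s > 0}` is covered by countably many zero sets in `Z` of
smaller dimension. The perturbations by constants are performed on the shells
`{2 δ j ≤ s ≤ 4 δ j}`, `δ j = 2 ^ (-(j + 2))`, and are glued together as an infimum, after a penalty
term has made each of them irrelevant off a neighbourhood of its shell. -/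
lemma IndLT.exists_perturb {n : ℕ} {Z : Set X} (hZ : IndLT (n + 1) Z) (u s : C(X, ℝ))
    (hs : ∀ x, 0 ≤ s x) :
    ∃ (v : C(X, ℝ)) (d : ℕ → C(X, ℝ)), (∀ x, |v x - u x| ≤ s x) ∧
      (∀ x ∈ Z, v x = 0 → 0 < s x → ∃ j, d j x = 0) ∧ ∀ j, IndLT n (Z ∩ {x | d j x = 0}) := by
  wlog hs1 : ∀ x, s x ≤ 1 generalizing s
  · obtain ⟨v, d, h1, h2, h3⟩ := this (s ⊓ 1) (fun x => by simp [hs x]) (fun x => by simp)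
    refine ⟨v, d, fun x => (h1 x).trans (by simp), fun x hx h0 hp => h2 x hx h0 (by simpa), h3⟩
  let δ : ℕ → ℝ := fun j => (1 / 2) ^ j / 4
  have hδ : ∀ j, 0 < δ j := fun j => by positivity
  let p : ℕ → C(X, ℝ) := fun j => ⟨fun x => 100 * max 0 (|s x - 3 * δ j| - δ j), by fun_prop⟩
  choose w hw hwZ using fun j => hZ.exists_perturb_const (u + p j) (hδ j)
  have hw' : ∀ j x, u x + p j x - δ j ≤ w j x ∧ w j x ≤ u x + p j x + δ j := fun j x => by
    have := abs_le.1 (hw j x)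
    simp only [ContinuousMap.add_apply] at this
    constructor <;> linarith [this.1, this.2]
  let r : ℕ → C(X, ℝ) := fun j => ⟨fun x => max 0 (u x + s x - w j x), by fun_prop⟩
  have hp0 : ∀ j x, 0 ≤ p j x := fun j x => by
    show 0 ≤ 100 * max 0 (|s x - 3 * δ j| - δ j)
    positivity
  have hpl : ∀ j x, 100 * (|s x - 3 * δ j| - δ j) ≤ p j x := fun j x =>
    mul_le_mul_of_nonneg_left (le_max_right _ _) (by norm_num)
  -- Off `{δ j ≤ s ≤ 5 δ j}` the penalty makes `w j` larger than `u + s`.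
  have far : ∀ j x, (s x < δ j ∨ 5 * δ j < s x) → r j x = 0 := by
    intro j x hx
    refine max_eq_left ?_
    have h1 := hpl j x
    have h2 := (hw' j x).1
    have h3 := hδ j
    rcases hx with hx | hx
    · have := neg_abs_le (s x - 3 * δ j); linarith
    · have := le_abs_self (s x - 3 * δ j); linarith
  have near : ∀ j x, r j x ≤ max 0 (s x + δ j) := by
    intro j x
    refine max_le_max le_rfl ?_
    linarith [hp0 j x, (hw' j x).1]
  obtain ⟨R, hR⟩ := exists_continuous_sup r (fun j => 6 * δ j)
    (by
      have := (tendsto_pow_atTop_nhds_zero_of_lt_one (r := (1 / 2 : ℝ)) (by norm_num)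
        (by norm_num)).const_mul (6 / 4)
      simp only [mul_zero] at this
      refine this.congr fun j => ?_
      simp only [δ]; ring)
    (fun j x => le_max_left _ _) (fun j x => by
      have := hδ j
      by_cases hx : s x < δ j ∨ 5 * δ j < s x
      · rw [far j x hx]; positivity
      · push Not at hx
        refine (near j x).trans (max_le (by positivity) (by linarith)))
  refine ⟨u + s - R, w, fun x => ?_, fun x hx hv hsx => ?_, hwZ⟩
  · have h1 : 0 ≤ R x := (le_max_left _ _).trans ((hR x).1 0)
    have h2 : R x ≤ 2 * s x := by
      rcases (hR x).2 with h | ⟨j, h⟩ <;> rw [h]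
      · linarith [hs x]
      · by_cases hx : s x < δ j ∨ 5 * δ j < s x
        · rw [far j x hx]; linarith [hs x]
        · push Not at hx
          refine (near j x).trans (max_le (by linarith [hs x]) (by linarith))
    simp only [ContinuousMap.sub_apply, ContinuousMap.add_apply, abs_le]
    constructor <;> linarith
  · simp only [ContinuousMap.sub_apply, ContinuousMap.add_apply] at hv
    obtain ⟨j, hj1, hj2⟩ := exists_nat_pow_near_of_lt_one hsx (hs1 x)
      (show (0 : ℝ) < 1 / 2 by norm_num) (by norm_num)
    -- `x` lies in the `j`-th shell, where there is no penalty.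
    have hl : 2 * δ j < s x := by
      have : 2 * δ j = (1 / 2) ^ (j + 1) := by simp only [δ]; ring
      linarith
    have hu : s x ≤ 4 * δ j := by
      have : 4 * δ j = (1 / 2) ^ j := by simp only [δ]; ring
      linarith
    have hp : p j x = 0 := by
      show 100 * max 0 (|s x - 3 * δ j| - δ j) = 0
      rw [max_eq_left, mul_zero]
      rw [sub_nonpos, abs_le]
      constructor <;> linarith
    have hRpos : 0 < R x := by
      have h1 : u x + s x - w j x ≤ r j x := le_max_right _ _
      linarith [(hR x).1 j, (hw' j x).2, hδ j]
    rcases (hR x).2 with h | ⟨i, h⟩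
    · linarith
    · refine ⟨i, ?_⟩
      have h1 : r i x = max 0 (u x + s x - w i x) := rfl
      rw [h1] at h
      rcases max_cases 0 (u x + s x - w i x) with h' | h' <;> linarith

/-- The countable sum theorem: a common bound on the dimension of countably many relative zero sets
covering `Z` is a bound on the dimension of `Z`. A function separating two closed sets is perturbed
successively; the `i`-th perturbation takes care of the `i`-th zero set and leaves the function
unchanged on the previous ones. -/
theorem IndLT.of_iUnion [CompactSpace X] [NormalSpace X] {n : ℕ} {Z : Set X} (d : ℕ → C(X, ℝ))
    (hd : ∀ j, IndLT n (Z ∩ {x | d j x = 0})) (hZ : ∀ x ∈ Z, ∃ j, d j x = 0) : IndLT n Z := by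
  induction n generalizing Z d with
  | zero =>
    refine eq_empty_of_forall_notMem fun x hx => ?_
    obtain ⟨j, hj⟩ := hZ x hx
    exact (eq_empty_iff_forall_notMem.1 (hd j)) x ⟨hx, hj⟩
  | succ n ih =>
    intro A B hA hB hAB
    obtain ⟨u0, hu0, hu1, -⟩ := exists_continuous_zero_one_of_isClosed hA hB hAB
    let c : ℕ → C(X, ℝ) := fun i => Nat.rec 1 (fun i c => c * |d i|) i
    have cS : ∀ i x, c (i + 1) x = c i x * |d i x| := fun i x => rfl
    have c0 : ∀ x, c 0 x = 1 := fun x => rfl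
    have c_nonneg : ∀ i x, 0 ≤ c i x := by
      intro i x
      induction i with
      | zero => rw [c0]; norm_num
      | succ i hi => rw [cS]; positivity
    have c_pos : ∀ i x, (∀ l < i, d l x ≠ 0) → 0 < c i x := by
      intro i x h
      induction i with
      | zero => rw [c0]; norm_num
      | succ i hi =>
        rw [cS]
        exact mul_pos (hi fun l hl => h l (by omega)) (abs_pos.2 (h i (by omega)))
    have c_zero : ∀ i x l, l < i → d l x = 0 → c i x = 0 := by
      intro i x l hl h
      induction i with
      | zero => omega
      | succ i hi =>
        rw [cS]
        rcases Nat.lt_succ_iff_lt_or_eq.1 hl with h' | rfl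
        · rw [hi h', zero_mul]
        · rw [h, abs_zero, mul_zero]
    let s : ℕ → C(X, ℝ) := fun i => c i ⊓ ContinuousMap.const X ((1 / 2 : ℝ) ^ i)
    have hs : ∀ i x, s i x = min (c i x) ((1 / 2 : ℝ) ^ i) := fun i x => rfl
    have hs0 : ∀ i x, 0 ≤ s i x := fun i x => by
      rw [hs]; exact le_min (c_nonneg i x) (by positivity)
    choose F D hF hD hDn using fun i (u : C(X, ℝ)) => (hd i).exists_perturb u (s i) (hs0 i)
    let v : ℕ → C(X, ℝ) := fun i =>
      Nat.rec (8 * u0 - 4) (fun i v => F i v) i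
    have vS : ∀ i, v (i + 1) = F i (v i) := fun i => rfl
    have hv : ∀ i x, |v (i + 1) x - v i x| ≤ s i x := fun i x => hF i (v i) x
    obtain ⟨w, hw0, hw⟩ := exists_continuous_lim v fun i x =>
      (hv i x).trans ((hs i x).trans_le (min_le_right _ _))
    have hv0 : ∀ x, v 0 x = 8 * u0 x - 4 := fun x => rfl
    refine ⟨w, fun x hx => ?_, fun x hx => ?_, ?_⟩
    · have h1 := (abs_le.1 (hw0 x)).2
      rw [hv0, hu0 hx.1] at h1
      simp only [Pi.zero_apply] at h1
      linarith
    · have h1 := (abs_le.1 (hw0 x)).1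
      rw [hv0, hu1 hx.1] at h1
      simp only [Pi.one_apply] at h1
      linarith
    · refine ih (fun m => |d m.unpair.1| + |D m.unpair.1 (v m.unpair.1) m.unpair.2|)
        (fun m => (hDn m.unpair.1 (v m.unpair.1) m.unpair.2).subset ?_) fun x hx => ?_
      · rintro x ⟨⟨hxZ, -⟩, hx⟩
        have hx' : |d m.unpair.1 x| + |D m.unpair.1 (v m.unpair.1) m.unpair.2 x| = 0 := hx
        have h1 := abs_nonneg (d m.unpair.1 x)
        have h2 := abs_nonneg (D m.unpair.1 (v m.unpair.1) m.unpair.2 x)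
        exact ⟨⟨hxZ, abs_eq_zero.1 (by linarith)⟩, abs_eq_zero.1 (by linarith)⟩
      · -- For the first `i` with `d i x = 0`, the sequence `v` is constant at `x` after `i + 1`.
        classical
        have hex := hZ x hx.1
        set i := Nat.find hex
        have hdi : d i x = 0 := Nat.find_spec hex
        have hstat : w x = v (i + 1) x := by
          refine hw x (i + 1) fun l hl => ?_
          have h1 := hv l x
          rw [hs, c_zero l x i (by omega) hdi, min_eq_left (by positivity)] at h1
          exact sub_eq_zero.1 (abs_nonpos_iff.1 h1)
        have hwx : w x = 0 := hx.2
        have hsx : 0 < s i x := by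
          rw [hs]
          exact lt_min (c_pos i x fun l hl => Nat.find_min hex hl) (by positivity)
        obtain ⟨j, hj⟩ := hD i (v i) x ⟨hx.1, hdi⟩ (by rw [← vS, ← hstat, hwx]) hsx
        refine ⟨Nat.pair i j, ?_⟩
        simp [hdi, hj]

end IndLT

/-! ### Zero sets and partitions -/

section ZeroSets

variable {T : Type*} [TopologicalSpace T] [CompactSpace T] [T2Space T]

/-- In a compact Hausdorff space, the closed `Gδ` sets are zero sets. -/
lemma exists_continuous_zero_iff_mem {L : Set T} (hL : IsGδ L) (hc : IsClosed L) :
    ∃ d : C(T, ℝ), (∀ x, 0 ≤ d x) ∧ (∀ x, d x ≤ 1) ∧ ∀ x, d x = 0 ↔ x ∈ L := by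
  obtain ⟨g, h1, -, -, h2⟩ := exists_continuous_one_zero_of_isCompact_of_isGδ hc.isCompact hL
    isClosed_empty (disjoint_empty L)
  refine ⟨1 - g, fun x => ?_, fun x => ?_, fun x => ?_⟩
  · have := (h2 x).2
    simpa using this
  · have := (h2 x).1
    simpa using this
  · rw [h1]
    show 1 - g x = 0 ↔ g x = 1
    rw [sub_eq_zero, eq_comm]

/-- A `Gδ` partition in a compact Hausdorff space is the zero set of a continuous function that is
negative on one side of it and positive on the other. -/
lemma exists_continuous_of_isGδ_of_compl_eq_union {L U V : Set T} (hL : IsGδ L) (hU : IsOpen U)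
    (hV : IsOpen V) (hUV : Disjoint U V) (hLc : Lᶜ = U ∪ V) :
    ∃ h : C(T, ℝ), (∀ x ∈ U, h x < 0) ∧ (∀ x ∈ V, 0 < h x) ∧ ∀ x, h x = 0 ↔ x ∈ L := by
  classical
  have hc : IsClosed L := by rw [← isOpen_compl_iff, hLc]; exact hU.union hV
  obtain ⟨d, d0, -, d1⟩ := exists_continuous_zero_iff_mem hL hc
  have hLU : ∀ x ∈ U ∪ V, 0 < d x := fun x hx =>
    lt_of_le_of_ne (d0 x) fun h => by rw [← hLc] at hx; exact hx ((d1 x).1 h.symm)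
  have hfr : ∀ x ∈ frontier U, d x = 0 := by
    intro x hx
    by_contra hne
    have hx' : x ∈ U ∪ V := by rw [← hLc]; exact fun h => hne ((d1 x).2 h)
    rw [hU.frontier_eq] at hx
    rcases hx' with h | h
    · exact hx.2 h
    · exact disjoint_left.1 (hUV.symm.closure_right hV) h hx.1
  refine ⟨⟨fun x => if x ∈ U then -d x else d x, ?_⟩, fun x hx => ?_, fun x hx => ?_,
    fun x => ?_⟩
  · refine Continuous.if (fun x hx => ?_) (by fun_prop) (by fun_prop)
    rw [hfr x hx, neg_zero]
  · simpa [hx] using hLU x (Or.inl hx)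
  · simpa [disjoint_right.1 hUV hx] using hLU x (Or.inr hx)
  · by_cases hx : x ∈ U <;> simp [hx, d1]

end ZeroSets

/-- On closed subspaces, the dimension `Ind₀` agrees with its description by functions on the ambient
space. -/
theorem indZeroLT_iff_indLT_range {X : Type*} [TopologicalSpace X] [CompactSpace X] [T2Space X]
    {n : ℕ} {T : Type*} [TopologicalSpace T] (e : T → X) (he : IsClosedEmbedding e) :
    IndZeroLT n T ↔ IndLT n (range e) := by
  induction n generalizing T with
  | zero =>
    rw [IndLT, range_eq_empty_iff]
    exact Iff.rfl
  | succ n ih =>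
    have : CompactSpace T := he.compactSpace
    have : T2Space T := he.isEmbedding.t2Space
    have hrange : ∀ (L : Set T) (h : C(X, ℝ)), (∀ t, h (e t) = 0 ↔ t ∈ L) →
        range (fun t : L => e t) = range e ∩ {x | h x = 0} := by
      intro L h hL
      ext x
      constructor
      · rintro ⟨t, rfl⟩
        exact ⟨mem_range_self _, (hL t).2 t.2⟩
      · rintro ⟨⟨t, rfl⟩, ht⟩
        exact ⟨⟨t, (hL t).1 ht⟩, rfl⟩
    constructor
    · intro hT A B hA hB hAB
      obtain ⟨L, hLG, ⟨hLc, U, V, hU, hV, hUV, hLUV, hAU, hBV⟩, hL⟩ :=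
        hT (e ⁻¹' A) (e ⁻¹' B) (hA.preimage he.continuous) (hB.preimage he.continuous)
          (hAB.preimage e)
      obtain ⟨g, g1, g2, g3⟩ := exists_continuous_of_isGδ_of_compl_eq_union hLG hU hV hUV hLUV
      obtain ⟨h, hh⟩ := ContinuousMap.exists_extension' he g
      have hg : ∀ t, h (e t) = g t := fun t => congrFun hh t
      refine ⟨h, ?_, ?_, ?_⟩
      · rintro _ ⟨hA', t, rfl⟩
        rw [hg]; exact g1 t (hAU hA')
      · rintro _ ⟨hB', t, rfl⟩
        rw [hg]; exact g2 t (hBV hB')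
      · rw [← hrange L h fun t => by rw [hg, g3]]
        exact (ih (fun t : L => e t) (he.comp hLc.isClosedEmbedding_subtypeVal)).1 hL
    · intro hT A B hA hB hAB
      obtain ⟨h, h1, h2, h3⟩ := hT (e '' A) (e '' B) (he.isClosedMap A hA) (he.isClosedMap B hB)
        ((disjoint_image_iff he.injective).2 hAB)
      have hcont : Continuous fun t => h (e t) := h.continuous.comp he.continuous
      have hLc : IsClosed {t | h (e t) = 0} := isClosed_eq hcont continuous_const
      refine ⟨{t | h (e t) = 0}, ?_, ⟨hLc, {t | h (e t) < 0}, {t | 0 < h (e t)},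
        isOpen_lt hcont continuous_const, isOpen_lt continuous_const hcont, ?_, ?_, ?_, ?_⟩, ?_⟩
      · exact (IsGδ.singleton (0 : ℝ)).preimage hcont
      · exact disjoint_left.2 fun t (h1 : h (e t) < 0) (h2 : 0 < h (e t)) => lt_asymm h1 h2
      · ext t
        exact lt_or_lt_iff_ne.symm
      · exact fun t ht => h1 _ ⟨mem_image_of_mem e ht, mem_range_self t⟩
      · exact fun t ht => h2 _ ⟨mem_image_of_mem e ht, mem_range_self t⟩
      · refine (ih (fun t : {t | h (e t) = 0} => e t)
          (he.comp hLc.isClosedEmbedding_subtypeVal)).2 ?_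
        rwa [hrange {t | h (e t) = 0} h fun t => Iff.rfl]

/-! ### Fully closed maps -/

section FullyClosed

variable {X Y : Type*} [TopologicalSpace X] [TopologicalSpace Y] [CompactSpace Y] {f : X → Y}

lemma IsFullyClosed.finite_inter (hf : IsFullyClosed f) {F G : Set X} (hF : IsClosed F)
    (hG : IsClosed G) (hFG : Disjoint F G) : (f '' F ∩ f '' G).Finite :=
  ((hf.isClosedMap F hF).inter (hf.isClosedMap G hG)).isCompact.finite
    (hf.isDiscrete_inter F G hF hG hFG)

/-- A continuous function oscillates by a given amount on finitely many fibers only. -/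
lemma IsFullyClosed.finite_oscillation [CompactSpace X] (hf : IsFullyClosed f) (u : C(X, ℝ))
    {δ : ℝ} (hδ : 0 < δ) :
    {y | ∃ x x', f x = y ∧ f x' = y ∧ u x + δ ≤ u x'}.Finite := by
  obtain ⟨C, hC⟩ : ∃ C, ∀ x, |u x| ≤ C := ⟨‖u‖, fun x => u.norm_coe_le_norm x⟩
  -- If `u x + δ ≤ u x'`, then two consecutive multiples of `δ / 3` lie between `u x` and `u x'`.
  have hfin := (finite_Icc (⌊-C / (δ / 3)⌋) (⌈C / (δ / 3)⌉ + 1)).biUnion fun i _ =>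
    hf.finite_inter (F := {x | u x ≤ i * (δ / 3)}) (G := {x | (i + 1) * (δ / 3) ≤ u x})
      (isClosed_le u.continuous continuous_const) (isClosed_le continuous_const u.continuous)
      (disjoint_left.2 fun x (h1 : u x ≤ _) (h2 : _ ≤ u x) => by nlinarith)
  refine hfin.subset ?_
  rintro y ⟨x, x', rfl, hx', h⟩
  have h3 : 0 < δ / 3 := by positivity
  have h1 := Int.le_ceil (u x / (δ / 3))
  have h2 := Int.ceil_lt_add_one (u x / (δ / 3))
  rw [div_le_iff₀ h3] at h1
  have h2' : (⌈u x / (δ / 3)⌉ : ℝ) * (δ / 3) < u x + δ / 3 := by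
    have := mul_lt_mul_of_pos_right h2 h3
    rwa [add_mul, div_mul_cancel₀ _ h3.ne', one_mul] at this
  refine mem_biUnion (x := ⌈u x / (δ / 3)⌉) ⟨?_, ?_⟩
    ⟨⟨x, h1, rfl⟩, ⟨x', ?_, hx'⟩⟩
  · refine (Int.floor_mono ?_).trans (Int.floor_le_ceil _)
    gcongr
    exact (abs_le.1 (hC x)).1
  · refine (Int.ceil_mono ?_).trans (Int.le_add_one le_rfl)
    gcongr
    exact (abs_le.1 (hC x)).2
  · show ((⌈u x / (δ / 3)⌉ : ℝ) + 1) * (δ / 3) ≤ u x'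
    linarith

end FullyClosed

/-! ### The upper bound -/

/-- A function that is continuous off a closed set `C` and tends to a continuous function at the
points of `C` is continuous. -/
lemma continuous_of_abs_sub_le {X : Type*} [TopologicalSpace X] {w g b : X → ℝ} (hg : Continuous g)
    (hb : Continuous b) (h : ∀ x, |w x - g x| ≤ b x) (hw : ContinuousOn w {x | b x ≠ 0}) :
    Continuous w := by
  refine continuous_iff_continuousAt.2 fun x => ?_
  by_cases hx : b x = 0
  · have hwx : w x = g x := by
      have := h x
      rw [hx] at this
      exact sub_eq_zero.1 (abs_nonpos_iff.1 this)
    have h1 : Filter.Tendsto b (𝓝 x) (𝓝 0) := hx ▸ hb.tendsto x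
    have h2 : Filter.Tendsto (fun z => w z - g z) (𝓝 x) (𝓝 0) :=
      squeeze_zero_norm (fun z => by rw [Real.norm_eq_abs]; exact h z) h1
    have h3 := h2.add (hg.tendsto x)
    simp only [sub_add_cancel, zero_add] at h3
    rw [ContinuousAt, hwx]
    exact h3
  · exact hw.continuousAt ((isOpen_ne_fun hb continuous_const).mem_nhds hx)

section Selection

variable {X Y : Type*} [TopologicalSpace X] [TopologicalSpace Y] [CompactSpace X] [CompactSpace Y]
  [T2Space Y] {f : X → Y}

/-- If the oscillation of `u` on the fibers of a closed map is smaller than a function `τ` wherever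
the latter is nonzero, then `τ * u` is approximated within `τ ^ 2` by a function constant on the
fibers. On `{τ ≠ 0}` one selects continuously a number that is `τ`-close to all values of `u` on
the fiber. -/
lemma exists_approx_of_oscillation_lt (hf : Continuous f) (hfc : IsClosedMap f) (u : C(X, ℝ))
    (τ : C(Y, ℝ)) (hτ0 : ∀ y, 0 ≤ τ y)
    (hτ : ∀ x x', f x = f x' → τ (f x) ≠ 0 → u x' - u x < τ (f x)) :
    ∃ w : C(Y, ℝ), ∀ x, |w (f x) - τ (f x) * u x| ≤ τ (f x) ^ 2 := by
  classical
  let O : Set Y := {y | τ y ≠ 0}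
  have hO : IsOpen O := isOpen_ne_fun τ.continuous continuous_const
  have : LocallyCompactSpace O := hO.locallyCompactSpace
  have : SigmaCompactSpace O := by
    rw [← isSigmaCompact_iff_sigmaCompactSpace]
    have : O = ⋃ n : ℕ, {y | 1 / ((n : ℝ) + 1) ≤ τ y} := by
      ext y
      simp only [mem_iUnion, mem_ofPred_eq, O]
      constructor
      · intro h
        obtain ⟨n, hn⟩ := exists_nat_one_div_lt (lt_of_le_of_ne (hτ0 y) (Ne.symm h))
        exact ⟨n, hn.le⟩
      · rintro ⟨n, hn⟩
        have : (0 : ℝ) < 1 / ((n : ℝ) + 1) := by positivity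
        exact (this.trans_le hn).ne'
    rw [this]
    exact isSigmaCompact_iUnion_of_isCompact _ fun n =>
      (isClosed_le continuous_const τ.continuous).isCompact
  obtain ⟨C, hC⟩ : ∃ C, ∀ x, |u x| ≤ C := ⟨‖u‖, fun x => u.norm_coe_le_norm x⟩
  let t : O → Set ℝ := fun y => {c | |c| ≤ max C 0 ∧ ∀ x, f x = y → |u x - c| ≤ τ y}
  have ht : ∀ y, Convex ℝ (t y) := by
    intro y
    have : t y = Metric.closedBall 0 (max C 0) ∩ ⋂ x, ⋂ (_ : f x = y),
        Metric.closedBall (u x) (τ y) := by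
      ext c
      simp [t, Real.dist_eq, abs_sub_comm]
    rw [this]
    exact (convex_closedBall _ _).inter (convex_iInter₂ fun x _ => convex_closedBall _ _)
  have hloc : ∀ y : O, ∃ c, ∀ᶠ z in 𝓝 y, c ∈ t z := by
    intro y
    obtain ⟨c, hc, hcy⟩ : ∃ c, |c| ≤ max C 0 ∧ ∀ x, f x = y → |u x - c| < τ y := by
      by_cases hy : ∃ x, f x = y
      · obtain ⟨x, hx⟩ := hy
        refine ⟨u x, (hC x).trans (le_max_left _ _), fun x' hx' => abs_lt.2 ⟨?_, ?_⟩⟩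
        · have := hτ x' x (by rw [hx, hx']) (by rw [hx']; exact y.2)
          rw [hx'] at this; linarith
        · have := hτ x x' (by rw [hx, hx']) (by rw [hx]; exact y.2)
          rw [hx] at this; linarith
      · exact ⟨0, by simp, fun x hx => (hy ⟨x, hx⟩).elim⟩
    refine ⟨c, ?_⟩
    have hcl : IsClosed (f '' {x | τ (f x) ≤ |u x - c|}) :=
      hfc _ (isClosed_le (by fun_prop) (by fun_prop))
    have hmem : (f '' {x | τ (f x) ≤ |u x - c|})ᶜ ∈ 𝓝 (y : Y) := by
      refine hcl.isOpen_compl.mem_nhds ?_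
      rintro ⟨x, hx, hxy⟩
      have h1 : τ (f x) ≤ |u x - c| := hx
      rw [hxy] at h1
      exact (hcy x hxy).not_ge h1
    filter_upwards [continuous_subtype_val.continuousAt hmem] with z hz
    refine ⟨hc, fun x hx => le_of_lt (not_le.1 fun h => hz ⟨x, ?_, hx⟩)⟩
    rw [← hx] at h
    exact h
  obtain ⟨v, hv⟩ := exists_continuous_forall_mem_convex_of_local_const ht hloc
  refine ⟨⟨fun y => if hy : y ∈ O then τ y * v ⟨y, hy⟩ else 0, ?_⟩, fun x => ?_⟩
  · refine continuous_of_abs_sub_le (g := fun _ => 0) (b := fun y => τ y * max C 0)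
      continuous_const (by fun_prop) (fun y => ?_) ?_
    · by_cases hy : y ∈ O
      · simp only [hy, dite_true, sub_zero, abs_mul, abs_of_nonneg (hτ0 y)]
        exact mul_le_mul_of_nonneg_left (hv ⟨y, hy⟩).1 (hτ0 y)
      · simp only [hy, dite_false, sub_zero, abs_zero]
        exact mul_nonneg (hτ0 y) (le_max_right _ _)
    · refine ContinuousOn.mono (s := O) ?_ fun y hy => left_ne_zero_of_mul hy
      rw [continuousOn_iff_continuous_domRestrict]
      have : O.domRestrict (fun y => if hy : y ∈ O then τ y * v ⟨y, hy⟩ else 0) =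
          fun y : O => τ y * v y := by
        funext y
        exact dif_pos y.2
      rw [this]
      fun_prop
  · by_cases hx : f x ∈ O
    · have h1 := (hv ⟨f x, hx⟩).2 x rfl
      simp only [ContinuousMap.coe_mk, hx, dite_true]
      rw [← mul_sub, abs_mul, abs_of_nonneg (hτ0 _), abs_sub_comm, pow_two]
      exact mul_le_mul_of_nonneg_left h1 (hτ0 _)
    · have h0 : τ (f x) = 0 := not_not.1 hx
      simp [hx, h0]

/-- A continuous function that vanishes exactly on a finite set `S` and dominates prescribed
constants tending to zero on finite sets disjoint from `S`. -/
lemma exists_continuous_gauge [FirstCountableTopology Y] {S : Set Y} (hS : S.Finite)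
    (D : ℕ → Set Y) (hD : ∀ j, (D j).Finite) (hDS : ∀ j, Disjoint S (D j)) :
    ∃ τ : C(Y, ℝ), (∀ y, 0 ≤ τ y) ∧ (∀ y, τ y ≤ 4) ∧ (∀ y, τ y = 0 ↔ y ∈ S) ∧
      ∀ j, ∀ y ∈ D j, 3 * (1 / 2) ^ j < τ y := by
  obtain ⟨s, hs0, hs1, hs⟩ := exists_continuous_zero_iff_mem hS.isGδ hS.isClosed
  choose t ht0 ht1 ht using fun j =>
    exists_continuous_zero_one_of_isClosed hS.isClosed (hD j).isClosed (hDS j)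
  have hpow : ∀ j : ℕ, (0 : ℝ) < 3 * (1 / 2) ^ j := fun j => by positivity
  obtain ⟨R, hR⟩ := exists_continuous_sup
    (fun j => ⟨fun y => 3 * (1 / 2) ^ j * t j y, by fun_prop⟩) (fun j => 3 * (1 / 2 : ℝ) ^ j)
    (by
      have := (tendsto_pow_atTop_nhds_zero_of_lt_one (r := (1 / 2 : ℝ)) (by norm_num)
        (by norm_num)).const_mul 3
      simpa using this)
    (fun j y => mul_nonneg (hpow j).le (ht j y).1)
    (fun j y => mul_le_of_le_one_right (hpow j).le (ht j y).2)
  simp only [ContinuousMap.coe_mk] at hR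
  have hR0 : ∀ y, 0 ≤ R y := fun y =>
    (mul_nonneg (hpow 0).le (ht 0 y).1).trans ((hR y).1 0)
  refine ⟨s + R, fun y => add_nonneg (hs0 y) (hR0 y), fun y => ?_, fun y => ?_,
    fun j y hy => ?_⟩
  · have : R y ≤ 3 := by
      rcases (hR y).2 with h | ⟨j, h⟩ <;> rw [h]
      · norm_num
      · refine (mul_le_of_le_one_right (hpow j).le (ht j y).2).trans ?_
        have := pow_le_one₀ (n := j) (show (0 : ℝ) ≤ 1 / 2 by norm_num) (by norm_num)
        linarith
    have := hs1 y
    simp only [ContinuousMap.add_apply]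
    linarith
  · simp only [ContinuousMap.add_apply]
    constructor
    · intro h
      exact (hs y).1 (by linarith [hs0 y, hR0 y])
    · intro h
      rw [(hs y).2 h, zero_add]
      rcases (hR y).2 with h' | ⟨j, h'⟩ <;> rw [h']
      rw [ht0 j h, Pi.zero_apply, mul_zero]
  · have h1 := (hR y).1 j
    rw [ht1 j hy, Pi.one_apply, mul_one] at h1
    have h2 : s y ≠ 0 := fun h => disjoint_left.1 (hDS j) ((hs y).1 h) hy
    have h3 := lt_of_le_of_ne (hs0 y) (Ne.symm h2)
    simp only [ContinuousMap.add_apply]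
    linarith

variable [T2Space X] [FirstCountableTopology Y]

lemma IndLT.inter_preimage_finite (hf : Continuous f) {W : Set X} {S : Set Y} {k : ℕ}
    (hS : S.Finite) (hW : ∀ y, IndLT k (W ∩ f ⁻¹' {y})) : IndLT k (W ∩ f ⁻¹' S) := by
  rcases S.eq_empty_or_nonempty with rfl | hne
  · simpa using IndLT.empty k
  obtain ⟨e, rfl⟩ := hS.countable.exists_eq_range hne
  choose d _ _ hd using fun y : Y =>
    exists_continuous_zero_iff_mem (IsGδ.singleton y) isClosed_singleton
  refine IndLT.of_iUnion (fun j => (d (e j)).comp ⟨f, hf⟩) (fun j => (hW (e j)).subset ?_)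
    fun x hx => ?_
  · rintro x ⟨⟨hx, -⟩, hx'⟩
    exact ⟨hx, (hd _ _).1 hx'⟩
  · obtain ⟨j, hj⟩ := hx.2
    exact ⟨j, (hd _ _).2 hj.symm⟩

/-- Fully closed maps satisfy the dimension-lowering inequality `Ind₀ X ≤ Ind₀ Y + Ind₀ f`. -/
theorem IsFullyClosed.indLT_add (hf : IsFullyClosed f) {n k : ℕ} {W : Set X} {Z : Set Y}
    (hWZ : MapsTo f W Z) (hZ : IndLT n Z) (hW : ∀ y, IndLT (k + 1) (W ∩ f ⁻¹' {y})) :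
    IndLT (n + k) W := by
  classical
  induction n generalizing W Z with
  | zero =>
    have : W = ∅ := eq_empty_of_forall_notMem fun x hx => by
      have := hWZ hx
      rw [show Z = ∅ from hZ] at this
      exact this
    rw [this]
    exact IndLT.empty _
  | succ n ih =>
    rw [Nat.succ_add]
    intro A B hA hB hAB
    obtain ⟨u0, hu0, hu1, -⟩ := exists_continuous_zero_one_of_isClosed hA hB hAB
    -- The values `-20` on `A` and `20` on `B` leave room for the total change, which is at most
    -- `1 + 2 * τ ≤ 9`.
    let u : C(X, ℝ) := 40 * u0 - 20
    have hu : ∀ x, u x = 40 * u0 x - 20 := fun x => rfl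
    let osc : C(X, ℝ) → ℝ → Set Y := fun u δ => {y | ∃ x x', f x = y ∧ f x' = y ∧ u x + δ ≤ u x'}
    -- Over the finite set `S` of fibers with large oscillation, `u` is replaced by a function whose
    -- zero set in these fibers has small dimension.
    let S : Set Y := osc u 1
    have hS : S.Finite := hf.finite_oscillation u one_pos
    obtain ⟨g, hgu, hg⟩ := (IndLT.inter_preimage_finite hf.continuous hS hW).exists_perturb_const
      u one_pos
    have hgu' : ∀ x, g x - u x ≤ 1 ∧ -1 ≤ g x - u x := fun x => (abs_le.1 (hgu x)).symm
    obtain ⟨τ, hτ0, hτ4, hτS, hτD⟩ := exists_continuous_gauge hS (fun j => osc g ((1 / 2) ^ j) \ S)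
      (fun j => (hf.finite_oscillation g (by positivity)).subset sdiff_subset)
      (fun j => disjoint_sdiff_self_right)
    have hτosc : ∀ x x', f x = f x' → τ (f x) ≠ 0 → g x' - g x < τ (f x) := by
      intro x x' hxx' hτx
      have hxS : f x ∉ S := fun h => hτx ((hτS _).2 h)
      have h3 : g x' - g x < 3 := by
        have : u x' < u x + 1 := not_le.1 fun h => hxS ⟨x, x', rfl, hxx'.symm, h⟩
        linarith [(hgu' x).2, (hgu' x').1]
      have hmem : ∀ j : ℕ, (1 / 2) ^ j ≤ g x' - g x → 3 * (1 / 2) ^ j < τ (f x) := fun j hj =>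
        hτD j (f x) ⟨⟨x, x', rfl, hxx'.symm, by linarith⟩, hxS⟩
      rcases le_or_gt (g x' - g x) 0 with h | h
      · exact h.trans_lt (lt_of_le_of_ne (hτ0 _) (Ne.symm hτx))
      rcases le_or_gt 1 (g x' - g x) with h1 | h1
      · have := hmem 0 (by simpa using h1)
        simp only [pow_zero] at this
        linarith
      · obtain ⟨j, hj1, hj2⟩ := exists_nat_pow_near_of_lt_one h h1.le
          (show (0 : ℝ) < 1 / 2 by norm_num) (by norm_num)
        have := hmem (j + 1) hj1.le
        rw [pow_succ] at this
        have : (0 : ℝ) < (1 / 2) ^ j := by positivity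
        linarith
    obtain ⟨w, hw⟩ := exists_approx_of_oscillation_lt hf.continuous hf.isClosedMap g τ hτ0 hτosc
    obtain ⟨v, d, hvw, hvd, hd⟩ := hZ.exists_perturb w (τ ^ 2) fun y => sq_nonneg (τ y)
    -- Off the fibers over `S`, the separating function is constant on the fibers.
    let h : X → ℝ := fun x => if τ (f x) = 0 then g x else v (f x) / τ (f x)
    have hhg : ∀ x, |h x - g x| ≤ 2 * τ (f x) := by
      intro x
      by_cases hx : τ (f x) = 0
      · simp [h, hx]
      · have hpos : 0 < τ (f x) := lt_of_le_of_ne (hτ0 _) (Ne.symm hx)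
        simp only [h, hx, if_false]
        have h1 := abs_le.1 (hw x)
        have h2 := abs_le.1 (hvw (f x))
        simp only [ContinuousMap.pow_apply] at h2
        have h3 : v (f x) / τ (f x) - g x = (v (f x) - τ (f x) * g x) / τ (f x) := by
          field_simp
        rw [h3, abs_div, abs_of_pos hpos, div_le_iff₀ hpos, abs_le]
        constructor <;> nlinarith
    have hcont : Continuous h := by
      have hfc := hf.continuous
      refine continuous_of_abs_sub_le g.continuous (b := fun x => 2 * τ (f x)) (by fun_prop) hhg ?_
      have : ContinuousOn (fun x => v (f x) / τ (f x)) {x | 2 * τ (f x) ≠ 0} :=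
        ContinuousOn.div (by fun_prop) (by fun_prop) fun x hx => right_ne_zero_of_mul hx
      refine this.congr fun x hx => ?_
      simp only [h, right_ne_zero_of_mul hx, if_false]
    refine ⟨⟨h, hcont⟩, fun x hx => ?_, fun x hx => ?_, ?_⟩
    · have h1 := hu x
      rw [hu0 hx.1, Pi.zero_apply] at h1
      show h x < 0
      linarith [(abs_le.1 (hhg x)).2, hτ4 (f x), (hgu' x).1]
    · have h1 := hu x
      rw [hu1 hx.1, Pi.one_apply] at h1
      show 0 < h x
      linarith [(abs_le.1 (hhg x)).1, hτ4 (f x), (hgu' x).2]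
    · let F : C(X, Y) := ⟨f, hf.continuous⟩
      refine IndLT.of_iUnion
        (fun m => Nat.casesOn m (τ.comp F) fun j => (d j).comp F) (fun m => ?_) fun x hx => ?_
      · rcases m with - | j
        · refine (hg.subset ?_).mono (Nat.le_add_left k n)
          rintro x ⟨⟨hx, hx0⟩, hx1⟩
          have hx1' : τ (f x) = 0 := hx1
          have hx0' : h x = 0 := hx0
          simp only [h, hx1', if_true] at hx0'
          exact ⟨⟨hx, (hτS _).1 hx1'⟩, hx0'⟩
        · refine ih (Z := Z ∩ {y | d j y = 0}) ?_ (hd j) fun y => (hW y).subset ?_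
          · rintro x ⟨⟨hx, -⟩, hx1⟩
            exact ⟨hWZ hx, hx1⟩
          · rintro x ⟨⟨⟨hx, -⟩, -⟩, hx1⟩
            exact ⟨hx, hx1⟩
      · by_cases hx1 : τ (f x) = 0
        · exact ⟨0, hx1⟩
        · have hx0 : h x = 0 := hx.2
          simp only [h, hx1, if_false, div_eq_zero_iff, or_false] at hx0
          obtain ⟨j, hj⟩ := hvd (f x) (hWZ hx.1) hx0 (pow_pos
            (lt_of_le_of_ne (hτ0 _) (Ne.symm hx1)) 2)
          exact ⟨j + 1, hj⟩

end Selection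

/-! ### The lower bound -/

/-- Recursive choice of sets, each subject to a condition on the union of the closures of the
previous ones. -/
lemma exists_seq_of_forall_isClosed {Y : Type*} [TopologicalSpace Y]
    (Q : ℕ → Set Y → Set Y → Prop) (hQ : ∀ i C, IsClosed C → ∃ G, Q i C G) :
    ∃ G : ℕ → Set Y, ∀ i, Q i (⋃ l < i, closure (G l)) (G i) := by
  choose! st hst using hQ
  let C : ℕ → Set Y := fun i => Nat.rec ∅ (fun i C => C ∪ closure (st i C)) i
  have hC : ∀ i, C i = ⋃ l < i, closure (st l (C l)) := by
    intro i
    induction i with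
    | zero => simp [C]
    | succ i ih =>
      rw [biUnion_lt_succ, ← ih]
  have hcl : ∀ i, IsClosed (C i) := by
    intro i
    induction i with
    | zero => exact isClosed_empty
    | succ i ih => exact ih.union isClosed_closure
  refine ⟨fun i => st i (C i), fun i => ?_⟩
  rw [← hC]
  exact hst i (C i) (hcl i)

section LowerBound

variable {X Y : Type*} [TopologicalSpace X] [TopologicalSpace Y] [CompactSpace X] [CompactSpace Y]
  [T2Space Y] {f : X → Y}

/-- For a ring-like fully closed map `f`, the zero set of a function `h` on `X` that separates the
preimages of `A` and `B` contains the full preimage of a `Gδ` partition between `A` and `B`.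

Let `OU` and `OV` be the sets of fibers on which `h < 0` and `h > 0`. Besides the fibers inside
`{h = 0}`, only countably many fibers are left. Each of them meets `{h ≠ 0}`, so that ring-likeness
supplies arbitrarily small neighbourhoods of its image with boundary inside one of `OU` and `OV`.
Disjoint neighbourhoods `G i` of this kind are added to `OU` or `OV` accordingly, and their closures
are removed from the other set; the result is open because the `G i` are locally finite at the
points of `OU ∪ OV`. -/
lemma IsRingLike.exists_partition (hr : IsRingLike f) (hf : IsFullyClosed f)
    (hs : Function.Surjective f) (h : C(X, ℝ)) {A B : Set Y} (hA : IsClosed A) (hB : IsClosed B)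
    (hhA : ∀ x, f x ∈ A → h x < 0) (hhB : ∀ x, f x ∈ B → 0 < h x) :
    ∃ g : C(Y, ℝ), (∀ y ∈ A, g y < 0) ∧ (∀ y ∈ B, 0 < g y) ∧ ∀ x, g (f x) = 0 → h x = 0 := by
  classical
  have hker : ∀ {u : Set X}, IsOpen u → IsOpen (kernImage f u) :=
    isClosedMap_iff_kernImage.1 hf.isClosedMap
  let OU : Set Y := kernImage f {x | h x < 0}
  let OV : Set Y := kernImage f {x | 0 < h x}
  let M : Set Y := kernImage f {x | h x = 0}
  have OUo : IsOpen OU := hker (isOpen_lt h.continuous continuous_const)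
  have OVo : IsOpen OV := hker (isOpen_lt continuous_const h.continuous)
  have dUV : Disjoint OU OV := disjoint_left.2 fun y h1 h2 => by
    obtain ⟨x, hx⟩ := hs y
    exact lt_asymm (show h x < 0 from h1 hx) (h2 hx)
  have dUM : Disjoint OU M := disjoint_left.2 fun y h1 h2 => by
    obtain ⟨x, hx⟩ := hs y
    exact (h1 hx).ne (h2 hx)
  have dVM : Disjoint OV M := disjoint_left.2 fun y h1 h2 => by
    obtain ⟨x, hx⟩ := hs y
    exact (h1 hx).ne' (h2 hx)
  have hAU : A ⊆ OU := fun y hy x hx => hhA x (hx ▸ hy)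
  have hBV : B ⊆ OV := fun y hy x hx => hhB x (hx ▸ hy)
  let E : Set Y := (OU ∪ OV ∪ M)ᶜ
  have hE : ∀ y ∈ E, (∃ x, f x = y ∧ 0 ≤ h x) ∧ (∃ x, f x = y ∧ h x ≤ 0) ∧
      ∃ x, f x = y ∧ h x ≠ 0 := by
    intro y hy
    refine ⟨?_, ?_, ?_⟩
    · by_contra! hc
      exact hy (Or.inl (Or.inl fun x hx => hc x hx))
    · by_contra! hc
      exact hy (Or.inl (Or.inr fun x hx => hc x hx))
    · by_contra! hc
      exact hy (Or.inr fun x hx => hc x hx)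
  have hEfin : ∀ δ > 0, (E ∩ {y | ∃ x, f x = y ∧ δ ≤ |h x|}).Finite := by
    intro δ hδ
    have h1 := hf.finite_inter (F := {x | h x ≤ 0}) (G := {x | δ ≤ h x})
      (isClosed_le h.continuous continuous_const) (isClosed_le continuous_const h.continuous)
      (disjoint_left.2 fun x (h1 : h x ≤ 0) (h2 : δ ≤ h x) => by linarith)
    have h2 := hf.finite_inter (F := {x | 0 ≤ h x}) (G := {x | h x ≤ -δ})
      (isClosed_le continuous_const h.continuous) (isClosed_le h.continuous continuous_const)
      (disjoint_left.2 fun x (h1 : 0 ≤ h x) (h2 : h x ≤ -δ) => by linarith)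
    refine (h1.union h2).subset ?_
    rintro y ⟨hyE, x, hx, hδx⟩
    obtain ⟨⟨x1, hx1, h1⟩, ⟨x2, hx2, h2⟩, -⟩ := hE y hyE
    rcases le_abs.1 hδx with h' | h'
    · exact Or.inl ⟨⟨x2, h2, hx2⟩, ⟨x, h', hx⟩⟩
    · exact Or.inr ⟨⟨x1, h1, hx1⟩, ⟨x, show h x ≤ -δ by linarith, hx⟩⟩
  have hEc : E.Countable := by
    refine (countable_iUnion fun n : ℕ =>
      (hEfin (1 / ((n : ℝ) + 1)) (by positivity)).countable).mono fun y hy => ?_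
    obtain ⟨x, hx, hne⟩ := (hE y hy).2.2
    obtain ⟨n, hn⟩ := exists_nat_one_div_lt (abs_pos.2 hne)
    exact mem_iUnion.2 ⟨n, hy, x, hx, hn.le⟩
  obtain ⟨c, hc⟩ := countable_iff_exists_injOn.1 hEc
  obtain ⟨G, hG⟩ := exists_seq_of_forall_isClosed (Y := Y) (fun i C G => IsOpen G ∧ Disjoint C G ∧
    (∀ y ∈ E, c y = i → y ∈ C ∪ G) ∧ Disjoint G (A ∪ B) ∧ (frontier G ⊆ OU ∨ frontier G ⊆ OV) ∧
    ∀ δ > 0, (∀ y ∈ E, c y = i → ∀ x, f x = y → |h x| < δ) → ∀ x, f x ∈ G → |h x| < 2 * δ) (by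
      intro i C hC
      by_cases hy : ∃ y ∈ E, c y = i ∧ y ∉ C
      · obtain ⟨y, hyE, hyi, hyC⟩ := hy
        have hcomp : IsCompact (f ⁻¹' {y}) := (isClosed_singleton.preimage hf.continuous).isCompact
        obtain ⟨x0, hx0, hmax⟩ := hcomp.exists_isMaxOn (hs y) (h.continuous.abs.continuousOn)
        obtain ⟨x3, hx3, hne⟩ := (hE y hyE).2.2
        have hpos : 0 < |h x0| := (abs_pos.2 hne).trans_le (hmax hx3)
        let N : Set Y := Cᶜ ∩ (A ∪ B)ᶜ ∩ kernImage f {x | |h x| < 2 * |h x0|}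
        have hNo : IsOpen N := (hC.isOpen_compl.inter (hA.union hB).isOpen_compl).inter
          (hker (isOpen_lt (by fun_prop) continuous_const))
        have hyN : y ∈ N := by
          refine ⟨⟨hyC, ?_⟩, fun x hx => ?_⟩
          · rintro (hy | hy)
            · exact hyE (Or.inl (Or.inl (hAU hy)))
            · exact hyE (Or.inl (Or.inr (hBV hy)))
          · have : |h x| ≤ |h x0| := hmax hx
            show |h x| < 2 * |h x0|
            linarith
        obtain ⟨G, hGo, hyG, hGN, hfr⟩ : ∃ G, IsOpen G ∧ y ∈ G ∧ G ⊆ N ∧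
            (frontier G ⊆ OU ∨ frontier G ⊆ OV) := by
          rcases lt_or_gt_of_ne hne with hlt | hlt
          · obtain ⟨G, h1, h2, h3, h4⟩ := hr.exists_frontier x3 {x | h x < 0} N
              (isOpen_lt h.continuous continuous_const) hlt hNo (hx3 ▸ hyN)
            exact ⟨G, h1, hx3 ▸ h2, h3, Or.inl fun z hz x hx => h4 (by rwa [mem_preimage, hx])⟩
          · obtain ⟨G, h1, h2, h3, h4⟩ := hr.exists_frontier x3 {x | 0 < h x} N
              (isOpen_lt continuous_const h.continuous) hlt hNo (hx3 ▸ hyN)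
            exact ⟨G, h1, hx3 ▸ h2, h3, Or.inr fun z hz x hx => h4 (by rwa [mem_preimage, hx])⟩
        refine ⟨G, hGo, disjoint_right.2 fun z hz => (hGN hz).1.1, fun z hz hzi => Or.inr ?_,
          disjoint_left.2 fun z hz => (hGN hz).1.2, hfr, fun δ hδ hall x hx => ?_⟩
        · rwa [hc hz hyE (hzi.trans hyi.symm)]
        · have h1 : |h x| < 2 * |h x0| := (hGN hx).2 rfl
          have h2 := hall y hyE hyi x0 hx0
          linarith
      · push Not at hy
        exact ⟨∅, isOpen_empty, disjoint_empty _, fun y hyE hyi => Or.inl (hy y hyE hyi),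
          empty_disjoint _, Or.inl (by simp), fun δ _ _ x hx => hx.elim⟩)
  choose Go Gd GE GAB Gfr Gsmall using hG
  have Gcd : ∀ l i, l < i → Disjoint (closure (G l)) (G i) := fun l i hli =>
    (Gd i).mono_left (subset_biUnion_of_mem (u := fun l => closure (G l)) hli)
  have Gdisj : ∀ i l, i ≠ l → Disjoint (G i) (G l) := by
    intro i l hil
    rcases lt_or_gt_of_ne hil with h1 | h1
    · exact (Gcd i l h1).mono_left subset_closure
    · exact ((Gcd l i h1).mono_left subset_closure).symm
  have mem_closure_G : ∀ i, ∀ y ∈ closure (G i), y ∈ G i ∨ y ∈ frontier (G i) := by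
    intro i y hy
    rw [(Go i).frontier_eq]
    by_cases hyG : y ∈ G i
    · exact Or.inl hyG
    · exact Or.inr ⟨hy, hyG⟩
  have Gcover : ∀ y ∈ E, ∃ i, y ∈ G i := by
    intro y hy
    rcases GE (c y) y hy rfl with h1 | h1
    · simp only [mem_iUnion] at h1
      obtain ⟨l, -, hl⟩ := h1
      refine ⟨l, (mem_closure_G l y hl).resolve_right fun h2 => hy (Or.inl ?_)⟩
      exact (Gfr l).imp (fun h3 => h3 h2) fun h3 => h3 h2
    · exact ⟨c y, h1⟩
  -- Local finiteness: on a fiber in `OU ∪ OV`, `|h|` is bounded away from zero.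
  have Glf : ∀ y, (∀ x, f x = y → h x ≠ 0) →
      ∃ N, IsOpen N ∧ y ∈ N ∧ {i | ¬ Disjoint (G i) N}.Finite := by
    intro y hy
    have hcomp : IsCompact (f ⁻¹' {y}) := (isClosed_singleton.preimage hf.continuous).isCompact
    obtain ⟨x0, hx0, hmin⟩ := hcomp.exists_isMinOn (hs y) (h.continuous.abs.continuousOn)
    have hpos : 0 < |h x0| := abs_pos.2 (hy x0 hx0)
    refine ⟨kernImage f {x | |h x0| / 2 < |h x|}, hker (isOpen_lt continuous_const (by fun_prop)),
      fun x hx => ?_, ((hEfin (|h x0| / 4) (by positivity)).image c).subset fun i hi => ?_⟩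
    · have : |h x0| ≤ |h x| := hmin hx
      show |h x0| / 2 < |h x|
      linarith
    · by_contra hcon
      refine hi (disjoint_left.2 fun z hz hz' => ?_)
      obtain ⟨x, rfl⟩ := hs z
      have h1 : |h x0| / 2 < |h x| := hz' rfl
      have h2 := Gsmall i (|h x0| / 4) (by positivity) (fun y hyE hyi x hx => by
        by_contra! hle
        exact hcon ⟨y, ⟨hyE, x, hx, hle⟩, hyi⟩) x hz
      linarith
  have open_diff : ∀ (O : Set Y) (J : Set ℕ), IsOpen O → (∀ y ∈ O, ∀ x, f x = y → h x ≠ 0) →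
      IsOpen (O \ ⋃ i ∈ J, closure (G i)) := by
    intro O J hO hOne
    refine isOpen_iff_mem_nhds.2 fun y hy => ?_
    obtain ⟨N, hN, hyN, hfin⟩ := Glf y (hOne y hy.1)
    have hyJ : ∀ i ∈ J, y ∉ closure (G i) := fun i hi h1 => hy.2 (mem_biUnion hi h1)
    have h1 : ⋂ i ∈ {i | ¬ Disjoint (G i) N} ∩ J, (closure (G i))ᶜ ∈ 𝓝 y :=
      (Filter.biInter_mem (hfin.subset inter_subset_left)).2 fun i hi =>
        isClosed_closure.isOpen_compl.mem_nhds (hyJ i hi.2)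
    filter_upwards [hO.mem_nhds hy.1, hN.mem_nhds hyN, h1] with z hzO hzN hz
    refine ⟨hzO, fun hzJ => ?_⟩
    simp only [mem_iUnion] at hzJ
    obtain ⟨i, hiJ, hzi⟩ := hzJ
    by_cases hd : Disjoint (G i) N
    · exact disjoint_left.1 (hd.closure_left hN) hzi hzN
    · exact mem_iInter₂.1 hz i ⟨hd, hiJ⟩ hzi
  let J : Set ℕ := {i | frontier (G i) ⊆ OU}
  have hJc : ∀ i ∈ Jᶜ, frontier (G i) ⊆ OV := fun i hi => (Gfr i).resolve_left hi
  let U : Set Y := (OU \ ⋃ i ∈ Jᶜ, closure (G i)) ∪ ⋃ i ∈ J, G i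
  let V : Set Y := (OV \ ⋃ i ∈ J, closure (G i)) ∪ ⋃ i ∈ Jᶜ, G i
  let L : Set Y := M ∩ ⋂ i, (closure (G i))ᶜ
  have hUo : IsOpen U := (open_diff OU Jᶜ OUo fun y hy x hx => (hy hx).ne).union
    (isOpen_biUnion fun i _ => Go i)
  have hVo : IsOpen V := (open_diff OV J OVo fun y hy x hx => (hy hx).ne').union
    (isOpen_biUnion fun i _ => Go i)
  have hUV : Disjoint U V := by
    refine disjoint_left.2 ?_
    rintro y (⟨hy1, hy2⟩ | hy) (⟨hy3, hy4⟩ | hy')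
    · exact disjoint_left.1 dUV hy1 hy3
    · obtain ⟨i, hi, hyi⟩ := mem_iUnion₂.1 hy'
      exact hy2 (mem_biUnion hi (subset_closure hyi))
    · obtain ⟨i, hi, hyi⟩ := mem_iUnion₂.1 hy
      exact hy4 (mem_biUnion hi (subset_closure hyi))
    · obtain ⟨i, hi, hyi⟩ := mem_iUnion₂.1 hy
      obtain ⟨l, hl, hyl⟩ := mem_iUnion₂.1 hy'
      exact disjoint_left.1 (Gdisj i l fun hil => hl (hil ▸ hi)) hyi hyl
  have G_subset : ∀ i, G i ⊆ U ∪ V := fun i y hy => by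
    by_cases hi : i ∈ J
    · exact Or.inl (Or.inr (mem_biUnion hi hy))
    · exact Or.inr (Or.inr (mem_biUnion (show i ∈ Jᶜ from hi) hy))
  have hLc : Lᶜ = U ∪ V := by
    refine Subset.antisymm (fun y hy => ?_) ?_
    · by_contra hcon
      have hnG : ∀ i, y ∉ G i := fun i hi => hcon (G_subset i hi)
      have hyU : y ∉ OU := fun hyU => hcon <| Or.inl <| Or.inl ⟨hyU, fun hyJ => by
        obtain ⟨i, hi, hyi⟩ := mem_iUnion₂.1 hyJ
        exact disjoint_left.1 dUV hyU (hJc i hi ((mem_closure_G i y hyi).resolve_left (hnG i)))⟩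
      have hyV : y ∉ OV := fun hyV => hcon <| Or.inr <| Or.inl ⟨hyV, fun hyJ => by
        obtain ⟨i, hi, hyi⟩ := mem_iUnion₂.1 hyJ
        exact disjoint_left.1 dUV (hi ((mem_closure_G i y hyi).resolve_left (hnG i))) hyV⟩
      have hyM : y ∈ M := by
        by_contra hyM
        obtain ⟨i, hi⟩ := Gcover y fun h1 => h1.elim (fun h2 => h2.elim hyU hyV) hyM
        exact hnG i hi
      refine hy ⟨hyM, mem_iInter.2 fun i hyi => ?_⟩
      have hyf := (mem_closure_G i y hyi).resolve_left (hnG i)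
      exact (Gfr i).elim (fun h1 => hyU (h1 hyf)) fun h1 => hyV (h1 hyf)
    · rintro y (hy | hy) ⟨hyM, hyc⟩
      · rcases hy with hy | hy
        · exact disjoint_left.1 dUM hy.1 hyM
        · obtain ⟨i, -, hyi⟩ := mem_iUnion₂.1 hy
          exact mem_iInter.1 hyc i (subset_closure hyi)
      · rcases hy with hy | hy
        · exact disjoint_left.1 dVM hy.1 hyM
        · obtain ⟨i, -, hyi⟩ := mem_iUnion₂.1 hy
          exact mem_iInter.1 hyc i (subset_closure hyi)
  have hLG : IsGδ L := by
    have hMG : M = ⋂ n : ℕ, kernImage f {x | |h x| < 1 / ((n : ℝ) + 1)} := by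
      ext y
      simp only [mem_iInter]
      constructor
      · intro hy n x hx
        have h1 : h x = 0 := hy hx
        show |h x| < 1 / ((n : ℝ) + 1)
        rw [h1, abs_zero]
        positivity
      · intro hy x hx
        by_contra hne
        obtain ⟨n, hn⟩ := exists_nat_one_div_lt (abs_pos.2 hne)
        exact lt_asymm hn (hy n hx)
    refine IsGδ.inter ?_ (.iInter_of_isOpen fun i => isClosed_closure.isOpen_compl)
    rw [hMG]
    exact .iInter_of_isOpen fun n => hker (isOpen_lt (by fun_prop) continuous_const)
  obtain ⟨g, g1, g2, g3⟩ := exists_continuous_of_isGδ_of_compl_eq_union hLG hUo hVo hUV hLc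
  refine ⟨g, fun y hy => g1 y (Or.inl ⟨hAU hy, fun hyJ => ?_⟩),
    fun y hy => g2 y (Or.inl ⟨hBV hy, fun hyJ => ?_⟩), fun x hx => ((g3 _).1 hx).1 rfl⟩
  · obtain ⟨i, hi, hyi⟩ := mem_iUnion₂.1 hyJ
    rcases mem_closure_G i y hyi with h1 | h1
    · exact disjoint_left.1 (GAB i) h1 (Or.inl hy)
    · exact disjoint_left.1 dUV (hAU hy) (hJc i hi h1)
  · obtain ⟨i, hi, hyi⟩ := mem_iUnion₂.1 hyJ
    rcases mem_closure_G i y hyi with h1 | h1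
    · exact disjoint_left.1 (GAB i) h1 (Or.inr hy)
    · exact disjoint_left.1 dUV (hi h1) (hBV hy)

/-- If all fibers of a ring-like fully closed map have `Ind₀` at least `k`, then `Ind₀` of the
preimage of a closed set exceeds that of the set by at least `k`. -/
theorem IsRingLike.indLT_of_indLT_preimage (hr : IsRingLike f) (hf : IsFullyClosed f)
    (hs : Function.Surjective f) {k m : ℕ} (hk : ∀ y, ¬ IndLT k (f ⁻¹' {y})) {Z : Set Y}
    (hZc : IsClosed Z) (hZ : IndLT (m + k) (f ⁻¹' Z)) : IndLT m Z := by
  induction m generalizing Z with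
  | zero =>
    refine eq_empty_of_forall_notMem fun y hy => hk y ?_
    rw [zero_add] at hZ
    exact hZ.subset (preimage_mono (singleton_subset_iff.2 hy))
  | succ m ih =>
    intro A B hA hB hAB
    rw [Nat.succ_add] at hZ
    obtain ⟨h, h1, h2, h3⟩ := hZ (f ⁻¹' A) (f ⁻¹' B) (hA.preimage hf.continuous)
      (hB.preimage hf.continuous) (hAB.preimage f)
    obtain ⟨g, g1, g2, g3⟩ := hr.exists_partition hf hs h (hA.inter hZc) (hB.inter hZc)
      (fun x hx => h1 x hx) (fun x hx => h2 x hx)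
    refine ⟨g, g1, g2, ih (hZc.inter (isClosed_eq g.continuous continuous_const)) (h3.subset ?_)⟩
    exact fun x hx => ⟨hx.1, g3 x hx.2⟩

end LowerBound

/-! ### The dimension as an extended number -/

section IndZero

variable {X : Type*} [TopologicalSpace X] [CompactSpace X] [T2Space X]

lemma indZeroLT_iff_indLT_univ {n : ℕ} : IndZeroLT n X ↔ IndLT n (univ : Set X) := by
  rw [indZeroLT_iff_indLT_range id IsClosedEmbedding.id, range_id]

lemma indZero_lt_iff {n : ℕ} : indZero X < n ↔ IndZeroLT n X := by
  constructor
  · intro h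
    obtain ⟨d, hd, hdn⟩ := sInf_lt_iff.1 h
    exact hd n hdn
  · intro h
    have hmono : ∀ i, n ≤ i → IndZeroLT i X := fun i hi =>
      indZeroLT_iff_indLT_univ.2 ((indZeroLT_iff_indLT_univ.1 h).mono hi)
    rcases n with - | m
    · refine lt_of_le_of_lt (sInf_le (a := ⊥) fun i _ => hmono i (Nat.zero_le i)) ?_
      exact WithBot.bot_lt_coe _
    · refine lt_of_le_of_lt (sInf_le (a := (m : WithBot ℕ∞)) fun i hi => hmono i ?_) ?_
      · exact Nat.succ_le_of_lt (by exact_mod_cast hi)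
      · exact_mod_cast Nat.lt_succ_self m

lemma indZero_lt_iff_indLT {n : ℕ} : indZero X < n ↔ IndLT n (univ : Set X) :=
  indZero_lt_iff.trans indZeroLT_iff_indLT_univ

lemma indZero_coe_lt_iff {Z : Set X} (hZ : IsClosed Z) {n : ℕ} :
    indZero Z < n ↔ IndLT n Z := by
  have : CompactSpace Z := isCompact_iff_compactSpace.1 hZ.isCompact
  rw [indZero_lt_iff, indZeroLT_iff_indLT_range _ hZ.isClosedEmbedding_subtypeVal,
    Subtype.range_coe]

lemma exists_enat_eq_indZero [Nonempty X] : ∃ a : ℕ∞, indZero X = a := by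
  rcases h : indZero X with - | a
  · have h1 : indZero X < (0 : ℕ) := by rw [h]; exact WithBot.bot_lt_coe _
    exact ((indZero_lt_iff.1 h1 : IsEmpty X).false (Classical.arbitrary X)).elim
  · exact ⟨a, rfl⟩

end IndZero

theorem mainTheorem5 {X : Type*} {Y : Type*} [TopologicalSpace X] [TopologicalSpace Y]
    [T3Space X] [CompactSpace X] [Nonempty X] [T3Space Y] [FirstCountableTopology Y]
    (f : X → Y) (hring : IsRingLike f) (hfull : IsFullyClosed f)
    (hsurj : Function.Surjective f)
    (hfib : ∀ y : Y, indZero (f ⁻¹' {y}) = indZeroMap f) :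
    indZero X = indZero Y + indZeroMap f := by
  have : CompactSpace Y := hsurj.compactSpace hfull.continuous
  have hcl : ∀ y, IsClosed (f ⁻¹' {y}) := fun y => isClosed_singleton.preimage hfull.continuous
  have hfibLT : ∀ (n : ℕ) y, IndLT n (f ⁻¹' {y}) ↔ indZeroMap f < n := fun n y => by
    rw [← hfib y, indZero_coe_lt_iff (hcl y)]
  have : Nonempty Y := ‹Nonempty X›.map f
  obtain ⟨κ, hκ⟩ : ∃ κ : ℕ∞, indZeroMap f = κ := by
    obtain ⟨y⟩ := ‹Nonempty Y›
    have : Nonempty (f ⁻¹' {y}) := let ⟨x, hx⟩ := hsurj y; ⟨x, hx⟩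
    have : CompactSpace (f ⁻¹' {y}) := isCompact_iff_compactSpace.1 (hcl y).isCompact
    rw [← hfib y]
    exact exists_enat_eq_indZero
  obtain ⟨ξ, hξ⟩ := exists_enat_eq_indZero (X := X)
  obtain ⟨η, hη⟩ := exists_enat_eq_indZero (X := Y)
  have hX : ∀ n : ℕ, ξ < n ↔ IndLT n (univ : Set X) := fun n => by
    rw [← indZero_lt_iff_indLT, hξ]; norm_cast
  have hY : ∀ n : ℕ, η < n ↔ IndLT n (univ : Set Y) := fun n => by
    rw [← indZero_lt_iff_indLT, hη]; norm_cast
  have hF : ∀ (n : ℕ) y, κ < n ↔ IndLT n (f ⁻¹' {y}) := fun n y => by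
    rw [hfibLT, hκ]; norm_cast
  rw [hξ, hη, hκ]
  norm_cast
  have lower : ∀ m k : ℕ, (k : ℕ∞) ≤ κ → ξ < (m + k : ℕ) → η < m := fun m k hk h =>
    (hY m).2 <| hring.indLT_of_indLT_preimage hfull hsurj
      (fun y hy => ((hF k y).2 hy).not_ge hk) isClosed_univ ((hX (m + k)).1 h)
  have upper : ∀ n k : ℕ, η < n → κ < (k + 1 : ℕ) → ξ < (n + k : ℕ) := fun n k hn hk =>
    (hX _).2 <| hfull.indLT_add (mapsTo_univ f univ) ((hY n).1 hn) fun y => by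
      rw [univ_inter]; exact (hF _ y).1 hk
  induction κ using ENat.recTopCoe with
  | top =>
    rw [add_top]
    by_contra hne
    obtain ⟨n, rfl⟩ := ENat.ne_top_iff_exists.1 hne
    have h1 := lower 0 (n + 1) le_top (by exact_mod_cast (by omega : n < 0 + (n + 1)))
    exact absurd h1 (by simp)
  | coe k =>
    induction η using ENat.recTopCoe with
    | top =>
      rw [top_add]
      by_contra hne
      obtain ⟨n, rfl⟩ := ENat.ne_top_iff_exists.1 hne
      have h1 := lower (n + 1) k le_rfl (by exact_mod_cast (by omega : n < n + 1 + k))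
      exact absurd h1 not_top_lt
    | coe n =>
      have h1 := upper (n + 1) k (by exact_mod_cast Nat.lt_succ_self n)
        (by exact_mod_cast Nat.lt_succ_self k)
      obtain ⟨m, rfl⟩ := ENat.ne_top_iff_exists.1 (ne_top_of_lt h1)
      have h2 : m < n + 1 + k := by exact_mod_cast h1
      have h3 : ¬ m < n + k := fun h => by
        have h4 := lower n k le_rfl (by exact_mod_cast h)
        exact lt_irrefl _ h4
      exact_mod_cast (by omega : m = n + k)
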